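/- Let $C\subset\mathbb{R}^3$ be a cube with center $a$, let $0<t<1$, and let $C'$ be the image of $C$ under the homothety of ratio $t$ with center $a$ (so $C$ and $C'$ are two nested cubes whose edge lengths have ratio $t$). Let $q_1,\dots,q_8$ be the vertices of $C$, let $q_9,\dots,q_{16}$ be the vertices of $C'$, and let positive masses $m_1,\dots,m_{16}>0$ be placed at $q_1,\dots,q_{16}$. Suppose that the configuration is a central configuration, i.e. that there is $\lambda\in\mathbb{R}$ such that $$-\lambda\,(q_i-q_0)=\sum_{j\neq i} m_j\,\frac{q_j-q_i}{|q_j-q_i|^3},\qquad i=1,\dots,16,\qquad\text{where } q_0=\frac{\sum_{j} m_jq_j}{\sum_{j} m_j}.$$ Then the masses on each cube are equal: $m_1=\dots=m_8$ and $m_9=\dots=m_{16}$. -/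

import Mathlib

/-- A configuration `q` of finitely many point masses `m` is *central* if there is `lam : ℝ` with
`-lam (q i - q₀) = ∑_{j ≠ i} m j (q j - q i) / |q j - q i|³` for all `i`,
where `q₀ = (∑ m j q j) / (∑ m j)` is the center of mass.
(It is meant for positive masses at pairwise distinct positions.) -/
def IsCentralConfiguration {ι E : Type*} [Fintype ι] [DecidableEq ι]
    [NormedAddCommGroup E] [InnerProductSpace ℝ E] (m : ι → ℝ) (q : ι → E) : Prop :=
  ∃ lam : ℝ, ∀ i : ι,
    -lam • (q i - Finset.univ.centerMass m q) =
      ∑ j ∈ Finset.univ.erase i, (m j / ‖q j - q i‖ ^ 3) • (q j - q i)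

/-- The vertices of the cube in `ℝ³` with center `a`, edge directions given by the orthonormal
basis `b`, and edge length `2 * r`: the vertex labelled by the signs `ε = (ε₀, ε₁, ε₂)`, each
`1` or `-1`, is `a + r (ε₀ b₀ + ε₁ b₁ + ε₂ b₂)`. -/
noncomputable def cubeVertex (a : EuclideanSpace ℝ (Fin 3))
    (b : OrthonormalBasis (Fin 3) ℝ (EuclideanSpace ℝ (Fin 3))) (r : ℝ)
    (ε : Fin 3 → ℤˣ) : EuclideanSpace ℝ (Fin 3) :=
  a + r • ∑ k : Fin 3, ((ε k : ℤ) : ℝ) • b k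

/-- The 16 positions of two nested (concentric, homothetic) cubes whose edge lengths have ratio
`t`: the left summand labels the vertices of the cube of edge `2 * r`, the right summand the
corresponding vertices of its image under the homothety of ratio `t` about the center `a`. -/
noncomputable def nestedCubes (a : EuclideanSpace ℝ (Fin 3))
    (b : OrthonormalBasis (Fin 3) ℝ (EuclideanSpace ℝ (Fin 3))) (r t : ℝ) :
    (Fin 3 → ℤˣ) ⊕ (Fin 3 → ℤˣ) → EuclideanSpace ℝ (Fin 3) :=
  Sum.elim (cubeVertex a b r) (cubeVertex a b (t * r))

/-!
With the vertices of a cube labelled by sign vectors, every vertex sees the others as every other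
vertex does, up to a sign in each coordinate. So the `k`-th coordinate of the equations at the
vertices `ε` of one cube, multiplied by `ε k`, reads `f₁ * x + f₂ * y = α + β ε k`, where `x` and
`y` are the masses on the two cubes, `*` is convolution on the group of sign vectors, and `f₁`,
`f₂` depend only on the sizes of the cubes. The Walsh–Fourier transform turns convolutions into
products and annihilates the right-hand side at every nonempty set of coordinates `S ≠ {k}`. For
each nonempty `S` we are left with a `2 × 2` linear system for the coefficients of `x` and `y` at
`S`. Its diagonal entries differ by the positive factor `t⁻²`, by homogeneity of the force, and
its off-diagonal entries have opposite signs, because the Walsh coefficients at `S` and `S ∆ {k}`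
of the inverse cube of the distance have a ratio strictly between `t` and `1 / t`. Hence all
coefficients at nonempty sets vanish, which means that `x` and `y` are constant.
-/

open Finset
open scoped symmDiff

/-- The inverse cube of the distance between `u` and `t • v`, where `u` and `v` are unit vectors and
`x` is the cosine of their angle. -/
noncomputable def invCubeDist (t x : ℝ) : ℝ := 1 / √(1 - 2 * t * x + t ^ 2) ^ 3

lemma one_sub_two_mul_add_sq_pos {t x : ℝ} (ht0 : 0 ≤ t) (ht1 : t < 1) (hx : x ≤ 1) :
    0 < 1 - 2 * t * x + t ^ 2 := by
  have hsq : 0 < (1 - t) ^ 2 := pow_pos (sub_pos.2 ht1) 2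
  have htx : t * x ≤ t := mul_le_of_le_one_right ht0 hx
  linarith

lemma one_sub_mul_invCubeDist_one {t : ℝ} (ht : t < 1) :
    (1 - t) * invCubeDist t 1 = 1 / (1 - t) ^ 2 := by
  have hpos : 0 < 1 - t := sub_pos.2 ht
  rw [invCubeDist, show 1 - 2 * t * 1 + t ^ 2 = (1 - t) ^ 2 by ring, Real.sqrt_sq hpos.le]
  field_simp

lemma one_add_mul_invCubeDist_neg_one {t : ℝ} (ht : -1 < t) :
    (1 + t) * invCubeDist t (-1) = 1 / (1 + t) ^ 2 := by
  have hpos : 0 < 1 + t := neg_lt_iff_pos_add'.1 ht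
  rw [invCubeDist, show 1 - 2 * t * -1 + t ^ 2 = (1 + t) ^ 2 by ring, Real.sqrt_sq hpos.le]
  field_simp

lemma invCubeDist_lt_invCubeDist {t x y : ℝ} (ht0 : 0 < t) (ht1 : t < 1) (hxy : x < y)
    (hy : y ≤ 1) : invCubeDist t x < invCubeDist t y := by
  have hpos := one_sub_two_mul_add_sq_pos ht0.le ht1 hy
  unfold invCubeDist
  gcongr

-- The arithmetic mean of `1 / u ^ 3` and `1 / w ^ 3` is at least their geometric mean.
lemma two_mul_inv_cube_le {u v w : ℝ} (hu : 0 < u) (hw : 0 < w) (h : u * w ≤ v ^ 2) :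
    2 * (1 / v ^ 3) ≤ 1 / u ^ 3 + 1 / w ^ 3 := by
  have hgeom : (1 / v ^ 3) ^ 2 ≤ 1 / u ^ 3 * (1 / w ^ 3) := by
    calc (1 / v ^ 3) ^ 2 = 1 / (v ^ 2) ^ 3 := by rw [div_pow, one_pow, pow_right_comm]
      _ ≤ 1 / (u * w) ^ 3 := by gcongr
      _ = 1 / u ^ 3 * (1 / w ^ 3) := by rw [mul_pow, one_div_mul_one_div]
  refine le_of_sq_le_sq ?_ (by positivity)
  linarith [sq_nonneg (1 / u ^ 3 - 1 / w ^ 3)]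

lemma two_mul_invCubeDist_midpoint_le {t x y : ℝ} (ht0 : 0 ≤ t) (ht1 : t < 1) (hx : x ≤ 1)
    (hy : y ≤ 1) : 2 * invCubeDist t ((x + y) / 2) ≤ invCubeDist t x + invCubeDist t y := by
  have hx' := one_sub_two_mul_add_sq_pos ht0 ht1 hx
  have hy' := one_sub_two_mul_add_sq_pos ht0 ht1 hy
  have hxy' := one_sub_two_mul_add_sq_pos ht0 ht1 (by linarith : (x + y) / 2 ≤ 1)
  refine two_mul_inv_cube_le (Real.sqrt_pos.2 hx') (Real.sqrt_pos.2 hy') ?_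
  have hamgm := two_mul_le_add_sq √(1 - 2 * t * x + t ^ 2) √(1 - 2 * t * y + t ^ 2)
  rw [Real.sq_sqrt hx'.le, Real.sq_sqrt hy'.le] at hamgm
  rw [Real.sq_sqrt hxy'.le]
  linarith

lemma three_mul_sq_sub_one_le_two_mul_cube {s : ℝ} (hs : 0 ≤ s) : 3 * s ^ 2 - 1 ≤ 2 * s ^ 3 := by
  have h : 0 ≤ (s - 1) ^ 2 * (2 * s + 1) := by positivity
  linarith

/- The tangent to `z ↦ z ^ (3 / 2)` at `z = 1` bounds the cube of the distance from below by a
rational function. -/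
lemma invCubeDist_le {t x : ℝ} (ht0 : 0 ≤ t) (ht1 : t < 1) (hx : x ≤ 1)
    (hpos : 0 < 3 * (1 - 2 * t * x + t ^ 2) - 1) :
    invCubeDist t x ≤ 2 / (3 * (1 - 2 * t * x + t ^ 2) - 1) := by
  have hsq := one_sub_two_mul_add_sq_pos ht0 ht1 hx
  have htangent := three_mul_sq_sub_one_le_two_mul_cube (Real.sqrt_nonneg (1 - 2 * t * x + t ^ 2))
  rw [Real.sq_sqrt hsq.le] at htangent
  rw [invCubeDist, div_le_div_iff₀ (by positivity) hpos]
  linarith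

lemma invCubeDist_one_third_add_le {t : ℝ} (ht0 : 0 ≤ t) (ht1 : t < 1) :
    (1 + t) * invCubeDist t (1 / 3) + (1 - t) * invCubeDist t (-1 / 3) ≤ 2 + 2 * t ^ 2 := by
  have hα : 0 < 2 - 2 * t + 3 * t ^ 2 := by linarith [sq_nonneg (t - 1), sq_nonneg t]
  have hβ : 0 < 2 + 2 * t + 3 * t ^ 2 := by positivity
  have le_α : invCubeDist t (1 / 3) ≤ 2 / (2 - 2 * t + 3 * t ^ 2) :=
    (invCubeDist_le ht0 ht1 (by norm_num) (by linarith)).trans_eq (by ring)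
  have le_β : invCubeDist t (-1 / 3) ≤ 2 / (2 + 2 * t + 3 * t ^ 2) :=
    (invCubeDist_le ht0 ht1 (by norm_num) (by linarith)).trans_eq (by ring)
  have : 0 ≤ 1 - t := by linarith
  calc (1 + t) * invCubeDist t (1 / 3) + (1 - t) * invCubeDist t (-1 / 3)
      ≤ (1 + t) * (2 / (2 - 2 * t + 3 * t ^ 2)) + (1 - t) * (2 / (2 + 2 * t + 3 * t ^ 2)) := by
        gcongr
    _ = (8 + 20 * t ^ 2) / ((2 - 2 * t + 3 * t ^ 2) * (2 + 2 * t + 3 * t ^ 2)) := by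
        rw [mul_div_assoc', mul_div_assoc', div_add_div _ _ hα.ne' hβ.ne']
        ring
    _ ≤ 2 + 2 * t ^ 2 := by
        rw [div_le_iff₀ (by positivity)]
        have : 0 ≤ t ^ 2 * (4 + 34 * t ^ 2 + 18 * t ^ 4) := by positivity
        linarith

/- Multiplying by `u + v` turns the left-hand side into a polynomial in `t` and `u * v`, because
`u ^ 2` and `v ^ 2` are polynomials in `t`; then `1 ≤ u * v` and `2 ≤ u + v` suffice. -/
lemma mul_cube_sub_mul_cube_le {t u v : ℝ} (ht : 0 ≤ t) (hu : 0 < u) (hv : 0 < v)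
    (husq : u ^ 2 = 1 - 2 * t / 3 + t ^ 2) (hvsq : v ^ 2 = 1 + 2 * t / 3 + t ^ 2) :
    (3 - t) * v ^ 3 - (3 + t) * u ^ 3 ≤ 4 * t * (u * v) ^ 3 := by
  have hprod : 1 ≤ u * v := by
    refine (one_le_sq_iff₀ (by positivity)).1 ?_
    calc (1 : ℝ) ≤ 1 + 14 / 9 * t ^ 2 + t ^ 4 := by linarith [sq_nonneg t, pow_nonneg ht 4]
      _ = (u * v) ^ 2 := by rw [mul_pow, husq, hvsq]; ring
  have hsum : 2 ≤ u + v := by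
    refine le_of_sq_le_sq ?_ (by positivity)
    linarith [sq_nonneg (u - v)]
  have hfactor : ((3 - t) * v ^ 3 - (3 + t) * u ^ 3) * (u + v) =
      t * (8 * (1 + t ^ 2) - 4 * (1 + t ^ 2) ^ 2 + (4 - 2 * (1 + t ^ 2)) * (u * v)
        + 2 * (u * v) ^ 2) := by
    linear_combination
      (-(3 + t) * (u * v + u ^ 2 + (1 - 2 * t / 3 + t ^ 2)) - 2 * t * v ^ 2) * husq
        + ((3 - t) * (u * v + v ^ 2 + (1 + 2 * t / 3 + t ^ 2))
          - 2 * t * (1 - 2 * t / 3 + t ^ 2)) * hvsq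
  have hbound : 8 * (1 + t ^ 2) - 4 * (1 + t ^ 2) ^ 2 + (4 - 2 * (1 + t ^ 2)) * (u * v)
      + 2 * (u * v) ^ 2 ≤ 4 * (u * v) ^ 3 * (u + v) :=
    calc _ ≤ 4 + 2 * (u * v) + 2 * (u * v) ^ 2 := by
          have : 0 ≤ 4 * t ^ 4 + 2 * t ^ 2 * (u * v) := by positivity
          linarith
      _ ≤ 4 * (u * v) ^ 3 * 2 := by
          linarith [one_le_pow₀ hprod (n := 3), pow_le_pow_right₀ hprod (by norm_num : 1 ≤ 3),
            pow_le_pow_right₀ hprod (by norm_num : 2 ≤ 3)]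
      _ ≤ 4 * (u * v) ^ 3 * (u + v) := by gcongr
  refine le_of_mul_le_mul_right ?_ (by positivity : 0 < u + v)
  calc ((3 - t) * v ^ 3 - (3 + t) * u ^ 3) * (u + v) ≤ t * (4 * (u * v) ^ 3 * (u + v)) :=
        hfactor.trans_le (by gcongr)
    _ = 4 * t * (u * v) ^ 3 * (u + v) := by ring

lemma invCubeDist_one_third_sub_le {t : ℝ} (ht0 : 0 ≤ t) (ht1 : t < 1) :
    (3 - t) * invCubeDist t (1 / 3) - (3 + t) * invCubeDist t (-1 / 3) ≤ 4 * t := by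
  have hα := one_sub_two_mul_add_sq_pos ht0 ht1 (by norm_num : (1 / 3 : ℝ) ≤ 1)
  have hβ := one_sub_two_mul_add_sq_pos ht0 ht1 (by norm_num : (-1 / 3 : ℝ) ≤ 1)
  have hcubes := mul_cube_sub_mul_cube_le ht0 (Real.sqrt_pos.2 hα) (Real.sqrt_pos.2 hβ)
    (by rw [Real.sq_sqrt hα.le]; ring) (by rw [Real.sq_sqrt hβ.le]; ring)
  unfold invCubeDist
  rw [mul_one_div (3 - t), mul_one_div (3 + t),
    div_sub_div _ _ (by positivity) (by positivity), div_le_iff₀ (by positivity), ← mul_pow]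
  linarith

lemma one_lt_one_div_one_sub_mul_one_add_sq {t : ℝ} (ht0 : 0 < t) (ht1 : t < 1) :
    1 < 1 / ((1 - t) * (1 + t)) ^ 2 := by
  have hpos : 0 < (1 - t) * (1 + t) := mul_pos (sub_pos.2 ht1) (by positivity)
  have hlt : (1 - t) * (1 + t) < 1 := by linarith [pow_pos ht0 2]
  exact one_lt_one_div (pow_pos hpos 2) (pow_lt_one₀ hpos.le hlt two_ne_zero)

lemma lt_invCubeDist_one_add {t : ℝ} (ht0 : 0 < t) (ht1 : t < 1) :
    2 + 2 * t ^ 2 < (1 - t) * invCubeDist t 1 + (1 + t) * invCubeDist t (-1) := by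
  have hpos : 0 < 1 - t := sub_pos.2 ht1
  calc 2 + 2 * t ^ 2 < (2 + 2 * t ^ 2) * (1 / ((1 - t) * (1 + t)) ^ 2) :=
        lt_mul_of_one_lt_right (by positivity) (one_lt_one_div_one_sub_mul_one_add_sq ht0 ht1)
    _ = (1 - t) * invCubeDist t 1 + (1 + t) * invCubeDist t (-1) := by
        rw [one_sub_mul_invCubeDist_one ht1, one_add_mul_invCubeDist_neg_one (by linarith)]
        field_simp
        ring

lemma lt_invCubeDist_one_sub {t : ℝ} (ht0 : 0 < t) (ht1 : t < 1) :
    4 * t < (1 - t) * invCubeDist t 1 - (1 + t) * invCubeDist t (-1) := by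
  have hpos : 0 < 1 - t := sub_pos.2 ht1
  calc 4 * t < 4 * t * (1 / ((1 - t) * (1 + t)) ^ 2) :=
        lt_mul_of_one_lt_right (by positivity) (one_lt_one_div_one_sub_mul_one_add_sq ht0 ht1)
    _ = (1 - t) * invCubeDist t 1 - (1 + t) * invCubeDist t (-1) := by
        rw [one_sub_mul_invCubeDist_one ht1, one_add_mul_invCubeDist_neg_one (by linarith)]
        field_simp
        ring

section
variable {ι : Type*}

/-- The Walsh character of the group of sign vectors `{±1}^ι` attached to a set of coordinates. -/
def signChar (S : Finset ι) : (ι → ℤˣ) →* ℝ where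
  toFun ε := ∏ k ∈ S, ((ε k : ℤ) : ℝ)
  map_one' := by simp
  map_mul' ε η := by simp [prod_mul_distrib]

lemma signChar_apply (S : Finset ι) (ε : ι → ℤˣ) :
    signChar S ε = ∏ k ∈ S, ((ε k : ℤ) : ℝ) := rfl

lemma intUnit_mul_self (u : ℤˣ) : ((u : ℤ) : ℝ) * ((u : ℤ) : ℝ) = 1 := by
  rw [← Int.cast_mul, ← Units.val_mul, Int.units_mul_self, Units.val_one, Int.cast_one]

lemma sum_signChar_mul_signChar [Fintype ι] (ε η : ι → ℤˣ) :
    ∑ S, signChar S ε * signChar S η = if η = ε then 2 ^ Fintype.card ι else 0 := by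
  have hprod : ∑ S, signChar S ε * signChar S η =
      ∏ k, (1 + ((ε k : ℤ) : ℝ) * ((η k : ℤ) : ℝ)) := by
    simp only [signChar_apply, ← prod_mul_distrib, prod_one_add, powerset_univ]
  split_ifs with h
  · subst h
    simp only [hprod, intUnit_mul_self, one_add_one_eq_two, prod_const, card_univ]
  · obtain ⟨k, hk⟩ := Function.ne_iff.1 h
    rw [hprod, prod_eq_zero (mem_univ k)]
    rw [Int.units_ne_iff_eq_neg.1 hk, Units.val_neg, Int.cast_neg]
    linear_combination -intUnit_mul_self (ε k)

lemma signChar_ne_one {S : Finset ι} (hS : S.Nonempty) : signChar S ≠ 1 := by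
  classical
  obtain ⟨k, hk⟩ := hS
  intro h
  have := DFunLike.congr_fun h (Pi.mulSingle k (-1))
  rw [signChar_apply, prod_eq_single_of_mem k hk (fun j _ hj => by simp [hj])] at this
  norm_num at this

variable [DecidableEq ι]

lemma signChar_symmDiff (S T : Finset ι) :
    signChar (S ∆ T) = signChar S * signChar T := by
  ext ε
  have hinter : (∏ k ∈ S ∩ T, ((ε k : ℤ) : ℝ)) * ∏ k ∈ S ∩ T, ((ε k : ℤ) : ℝ) = 1 := by
    simp only [← prod_mul_distrib, intUnit_mul_self]
    exact prod_const_one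
  simp only [MonoidHom.mul_apply, signChar_apply, symmDiff_def, sup_eq_union]
  rw [prod_union (disjoint_sdiff_sdiff), ← prod_inter_mul_prod_sdiff S T,
    ← prod_inter_mul_prod_sdiff T S, inter_comm T S]
  linear_combination (-(∏ k ∈ S \ T, ((ε k : ℤ) : ℝ)) * ∏ k ∈ T \ S, ((ε k : ℤ) : ℝ)) * hinter

variable [Fintype ι]

/-- The unnormalized Walsh–Fourier coefficient at `S` of a function on the sign vectors. -/
def walshCoeff (S : Finset ι) : ((ι → ℤˣ) → ℝ) →ₗ[ℝ] ℝ where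
  toFun f := ∑ ε, signChar S ε * f ε
  map_add' f g := by simp [mul_add, sum_add_distrib]
  map_smul' c f := by simp [mul_sum, mul_left_comm]

lemma walshCoeff_apply (S : Finset ι) (f : (ι → ℤˣ) → ℝ) :
    walshCoeff S f = ∑ ε, signChar S ε * f ε := rfl

lemma walshCoeff_signChar_of_ne {S T : Finset ι} (h : S ≠ T) : walshCoeff S (signChar T) = 0 := by
  have hST : (S ∆ T).Nonempty := symmDiff_nonempty.2 h
  calc walshCoeff S (signChar T) = ∑ ε, signChar (S ∆ T) ε := by
        rw [signChar_symmDiff]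
        rfl
    _ = 0 := sum_hom_units_eq_zero _ (signChar_ne_one hST)

lemma walshCoeff_signChar_mul (S T : Finset ι) (f : (ι → ℤˣ) → ℝ) :
    walshCoeff S (fun ε => signChar T ε * f ε) = walshCoeff (S ∆ T) f := by
  simp only [walshCoeff_apply, signChar_symmDiff, MonoidHom.mul_apply, mul_assoc]

lemma walshCoeff_convolution (S : Finset ι) (f φ : (ι → ℤˣ) → ℝ) :
    walshCoeff S (fun ε => ∑ η, f η * φ (ε * η)) = walshCoeff S φ * walshCoeff S f := by
  have translate (η : ι → ℤˣ) :
      ∑ ε, signChar S ε * φ (ε * η) = walshCoeff S φ * signChar S η := by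
    have hη : η * η = 1 := funext fun k => Int.units_mul_self (η k)
    rw [walshCoeff_apply, sum_mul, ← Equiv.sum_comp (Equiv.mulRight η)]
    refine sum_congr rfl fun δ _ => ?_
    rw [Equiv.coe_mulRight, mul_assoc δ, hη, mul_one, map_mul, mul_right_comm]
  calc walshCoeff S (fun ε => ∑ η, f η * φ (ε * η))
      = ∑ η, (∑ ε, signChar S ε * φ (ε * η)) * f η := by
        simp only [walshCoeff_apply, mul_sum, sum_mul]
        rw [sum_comm]
        exact sum_congr rfl fun η _ => sum_congr rfl fun ε _ => by ring
    _ = walshCoeff S φ * walshCoeff S f := by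
        simp only [translate, walshCoeff_apply S f, mul_sum, mul_assoc]

lemma sum_walshCoeff_mul_signChar (f : (ι → ℤˣ) → ℝ) (ε : ι → ℤˣ) :
    ∑ S, walshCoeff S f * signChar S ε = 2 ^ Fintype.card ι * f ε :=
  calc ∑ S, walshCoeff S f * signChar S ε
      = ∑ η, (∑ S, signChar S ε * signChar S η) * f η := by
        simp only [walshCoeff_apply, sum_mul]
        rw [sum_comm]
        exact sum_congr rfl fun η _ => sum_congr rfl fun S _ => by ring
    _ = 2 ^ Fintype.card ι * f ε := by simp [sum_signChar_mul_signChar]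

lemma eq_of_walshCoeff_eq_zero {f : (ι → ℤˣ) → ℝ}
    (hf : ∀ S : Finset ι, S.Nonempty → walshCoeff S f = 0) (ε η : ι → ℤˣ) : f ε = f η := by
  have hconst (ε : ι → ℤˣ) : 2 ^ Fintype.card ι * f ε = walshCoeff ∅ f := by
    rw [← sum_walshCoeff_mul_signChar, Fintype.sum_eq_single ∅ fun S hS => by
      rw [hf S (nonempty_iff_ne_empty.2 hS), zero_mul]]
    simp [signChar_apply]
  exact mul_left_cancel₀ (by positivity : (2 : ℝ) ^ Fintype.card ι ≠ 0)
    ((hconst ε).trans (hconst η).symm)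

end

/- The coefficients are the values at `#S` of the Krawtchouk polynomials, which are the Walsh
coefficients of the spheres of the Hamming cube. -/
lemma walshCoeff_comp_sum (φ : ℤ → ℝ) (S : Finset (Fin 3)) :
    walshCoeff S (fun δ => φ (∑ k, (δ k : ℤ))) =
      φ 3 + (3 - 2 * #S) * φ 1 + (3 - 6 * #S + 2 * #S ^ 2) * φ (-1) + (-1) ^ #S * φ (-3) := by
  have mem_levels : ∀ δ : Fin 3 → ℤˣ, ∑ k, (δ k : ℤ) ∈ ({3, 1, -1, -3} : Finset ℤ) := by decide
  have level_sums : ∀ S : Finset (Fin 3),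
      ∑ δ : Fin 3 → ℤˣ with ∑ k, (δ k : ℤ) = 3, ∏ k ∈ S, (δ k : ℤ) = 1 ∧
      ∑ δ : Fin 3 → ℤˣ with ∑ k, (δ k : ℤ) = 1, ∏ k ∈ S, (δ k : ℤ) = 3 - 2 * #S ∧
      ∑ δ : Fin 3 → ℤˣ with ∑ k, (δ k : ℤ) = -1, ∏ k ∈ S, (δ k : ℤ) = 3 - 6 * #S + 2 * #S ^ 2 ∧
      ∑ δ : Fin 3 → ℤˣ with ∑ k, (δ k : ℤ) = -3, ∏ k ∈ S, (δ k : ℤ) = (-1) ^ #S := by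
    decide
  obtain ⟨h3, h1, hn1, hn3⟩ := level_sums S
  have hlevel (n : ℤ) : ∑ δ : Fin 3 → ℤˣ with ∑ k, (δ k : ℤ) = n,
        signChar S δ * φ (∑ k, (δ k : ℤ)) =
      ((∑ δ : Fin 3 → ℤˣ with ∑ k, (δ k : ℤ) = n, ∏ k ∈ S, (δ k : ℤ) : ℤ) : ℝ) * φ n := by
    rw [Int.cast_sum, sum_mul]
    refine sum_congr rfl fun δ hδ => ?_
    rw [(mem_filter.1 hδ).2, signChar_apply, Int.cast_prod]
  rw [walshCoeff_apply, ← sum_fiberwise_of_maps_to fun δ _ => mem_levels δ]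
  simp only [hlevel]
  rw [sum_insert (by decide), sum_insert (by decide), sum_insert (by decide), sum_singleton,
    h3, h1, hn1, hn3]
  push_cast
  ring

/-- The inverse cube of the distance from the vertex `(1, 1, 1)` to the vertex `δ` of the `t` times
smaller cube, when the larger cube is inscribed in the unit sphere: `(∑ k, δ k) / 3` is the cosine
of the angle between the two vertices. -/
noncomputable def cubeKernel (t : ℝ) (δ : Fin 3 → ℤˣ) : ℝ :=
  invCubeDist t ((∑ k, (δ k : ℤ) : ℤ) / 3)

lemma walshCoeff_cubeKernel (t : ℝ) (S : Finset (Fin 3)) :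
    walshCoeff S (cubeKernel t) = invCubeDist t 1 + (3 - 2 * #S) * invCubeDist t (1 / 3) +
      (3 - 6 * #S + 2 * #S ^ 2) * invCubeDist t (-1 / 3) + (-1) ^ #S * invCubeDist t (-1) := by
  have h := walshCoeff_comp_sum (fun n => invCubeDist t (n / 3)) S
  simp only [Int.cast_neg, Int.cast_ofNat, Int.cast_one, neg_div, div_self (three_ne_zero' ℝ)] at h
  rwa [← neg_div] at h

lemma mul_walshCoeff_one_lt_two {t : ℝ} (ht0 : 0 < t) (ht1 : t < 1) {S T : Finset (Fin 3)}
    (hS : #S = 1) (hT : #T = 2) :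
    t * walshCoeff S (cubeKernel t) < walshCoeff T (cubeKernel t) := by
  rw [walshCoeff_cubeKernel, walshCoeff_cubeKernel, hS, hT]
  norm_num
  linarith [invCubeDist_one_third_add_le ht0.le ht1, lt_invCubeDist_one_add ht0 ht1]

lemma mul_walshCoeff_two_lt_three {t : ℝ} (ht0 : 0 < t) (ht1 : t < 1) {S T : Finset (Fin 3)}
    (hS : #S = 2) (hT : #T = 3) :
    t * walshCoeff S (cubeKernel t) < walshCoeff T (cubeKernel t) := by
  rw [walshCoeff_cubeKernel, walshCoeff_cubeKernel, hS, hT]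
  norm_num
  linarith [invCubeDist_one_third_sub_le ht0.le ht1, lt_invCubeDist_one_sub ht0 ht1]

lemma walshCoeff_two_lt_one {t : ℝ} (ht0 : 0 < t) (ht1 : t < 1) {S T : Finset (Fin 3)}
    (hS : #S = 1) (hT : #T = 2) :
    walshCoeff T (cubeKernel t) < walshCoeff S (cubeKernel t) := by
  rw [walshCoeff_cubeKernel, walshCoeff_cubeKernel, hS, hT]
  norm_num
  linarith [invCubeDist_lt_invCubeDist ht0 ht1 (by norm_num : (-1 : ℝ) < 1 / 3) (by norm_num)]

lemma walshCoeff_three_le_two {t : ℝ} (ht0 : 0 < t) (ht1 : t < 1) {S T : Finset (Fin 3)}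
    (hS : #S = 2) (hT : #T = 3) :
    walshCoeff T (cubeKernel t) ≤ walshCoeff S (cubeKernel t) := by
  have hmid : 2 * invCubeDist t (-1 / 3) ≤ invCubeDist t (1 / 3) + invCubeDist t (-1) := by
    convert two_mul_invCubeDist_midpoint_le ht0.le ht1 (x := 1 / 3) (y := -1) _ _ using 3 <;>
      norm_num
  rw [walshCoeff_cubeKernel, walshCoeff_cubeKernel, hS, hT]
  norm_num
  linarith

lemma walshCoeff_two_pos {t : ℝ} (ht0 : 0 < t) (ht1 : t < 1) {T : Finset (Fin 3)}
    (hT : #T = 2) : 0 < walshCoeff T (cubeKernel t) := by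
  have hone : #{(0 : Fin 3)} = 1 := card_singleton 0
  have hlt := mul_walshCoeff_one_lt_two ht0 ht1 hone hT
  have hgt := walshCoeff_two_lt_one ht0 ht1 hone hT
  have hself := (mul_lt_mul_of_pos_left hgt ht0).trans hlt
  exact (mul_pos_iff_of_pos_left (sub_pos.2 ht1)).1 (by linarith)

lemma mul_walshCoeff_cubeKernel_lt {t : ℝ} (ht0 : 0 < t) (ht1 : t < 1) {S : Finset (Fin 3)}
    {k : Fin 3} (hS : S.Nonempty) (hSk : S ≠ {k}) :
    t * walshCoeff S (cubeKernel t) < walshCoeff (S ∆ {k}) (cubeKernel t) := by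
  have hcard : ∀ (S : Finset (Fin 3)) (k : Fin 3), S.Nonempty → S ≠ {k} →
      #S = 1 ∧ #(S ∆ {k}) = 2 ∨ #S = 2 ∧ #(S ∆ {k}) = 1 ∨
      #S = 2 ∧ #(S ∆ {k}) = 3 ∨ #S = 3 ∧ #(S ∆ {k}) = 2 := by decide
  rcases hcard S k hS hSk with ⟨h, hk⟩ | ⟨h, hk⟩ | ⟨h, hk⟩ | ⟨h, hk⟩
  · exact mul_walshCoeff_one_lt_two ht0 ht1 h hk
  · exact (mul_lt_of_lt_one_left (walshCoeff_two_pos ht0 ht1 h) ht1).trans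
      (walshCoeff_two_lt_one ht0 ht1 hk h)
  · exact mul_walshCoeff_two_lt_three ht0 ht1 h hk
  · exact (mul_le_mul_of_nonneg_left (walshCoeff_three_le_two ht0 ht1 hk h) ht0.le).trans_lt
      (mul_lt_of_lt_one_left (walshCoeff_two_pos ht0 ht1 hk) ht1)

section

variable {ι : Type*} [Fintype ι]

/-- The distance from the vertex `(1, …, 1)` of the cube of half edge `s` to the vertex `δ` of the
concentric cube of half edge `s'`. -/
noncomputable def vertexDist (s s' : ℝ) (δ : ι → ℤˣ) : ℝ :=
  √(∑ k, (s' * ((δ k : ℤ) : ℝ) - s) ^ 2)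

/-- The `k`-th coordinate of the attraction exerted on the vertex `(1, …, 1)` of the cube of half
edge `s` by a unit mass at the vertex `δ` of the concentric cube of half edge `s'`. It is `0` if
both vertices coincide, because of the division by `0`. -/
noncomputable def vertexForce (k : ι) (s s' : ℝ) (δ : ι → ℤˣ) : ℝ :=
  (s' * ((δ k : ℤ) : ℝ) - s) / vertexDist s s' δ ^ 3

lemma vertexDist_comm (s s' : ℝ) (δ : ι → ℤˣ) : vertexDist s s' δ = vertexDist s' s δ := by
  refine congrArg Real.sqrt (sum_congr rfl fun k _ => ?_)
  linear_combination (s' ^ 2 - s ^ 2) * intUnit_mul_self (δ k)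

lemma vertexDist_mul {c : ℝ} (hc : 0 ≤ c) (s s' : ℝ) (δ : ι → ℤˣ) :
    vertexDist (c * s) (c * s') δ = c * vertexDist s s' δ := by
  simp only [vertexDist, mul_assoc, ← mul_sub, mul_pow, ← mul_sum]
  rw [Real.sqrt_mul (sq_nonneg c), Real.sqrt_sq hc]

lemma vertexForce_mul {c : ℝ} (hc : 0 < c) (k : ι) (s s' : ℝ) :
    vertexForce k (c * s) (c * s') = (c ^ 2)⁻¹ • vertexForce k s s' := by
  ext δ
  rw [Pi.smul_apply, smul_eq_mul, vertexForce, vertexForce, vertexDist_mul hc.le]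
  field_simp

lemma walshCoeff_vertexForce [DecidableEq ι] (k : ι) (s s' : ℝ) (S : Finset ι) :
    walshCoeff S (vertexForce k s s') =
      s' * walshCoeff (S ∆ {k}) (fun δ => 1 / vertexDist s s' δ ^ 3) -
        s * walshCoeff S (fun δ => 1 / vertexDist s s' δ ^ 3) := by
  rw [← walshCoeff_signChar_mul, ← smul_eq_mul, ← smul_eq_mul, ← map_smul, ← map_smul, ← map_sub]
  congr 1
  ext δ
  simp only [vertexForce, signChar_apply, prod_singleton, Pi.sub_apply, Pi.smul_apply, smul_eq_mul]
  ring

end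

lemma one_div_vertexDist_cube {r : ℝ} (hr : 0 ≤ r) (t : ℝ) :
    (fun δ : Fin 3 → ℤˣ => 1 / vertexDist r (t * r) δ ^ 3) =
      (1 / (√3 * r) ^ 3) • cubeKernel t := by
  ext δ
  have hsq : ∑ k, (t * r * ((δ k : ℤ) : ℝ) - r) ^ 2 =
      (√3 * r) ^ 2 * (1 - 2 * t * ((∑ k, (δ k : ℤ) : ℤ) / 3) + t ^ 2) := by
    rw [mul_pow, Real.sq_sqrt zero_le_three]
    simp only [Fin.sum_univ_three]
    push_cast
    linear_combination t ^ 2 * r ^ 2 * (intUnit_mul_self (δ 0) + intUnit_mul_self (δ 1)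
      + intUnit_mul_self (δ 2))
  rw [vertexDist, hsq, Real.sqrt_mul (sq_nonneg _), Real.sqrt_sq (by positivity), mul_pow,
    Pi.smul_apply, smul_eq_mul, cubeKernel, invCubeDist, one_div_mul_one_div]

lemma walshCoeff_vertexForce_neg {r t : ℝ} (hr : 0 < r) (ht0 : 0 < t) (ht1 : t < 1)
    {S : Finset (Fin 3)} {k : Fin 3} (hS : S.Nonempty) (hSk : S ≠ {k}) :
    walshCoeff S (vertexForce k r (t * r)) < 0 := by
  have hlt := mul_walshCoeff_cubeKernel_lt (S := S ∆ {k}) (k := k) ht0 ht1 (symmDiff_nonempty.2 hSk)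
    (fun h => hS.ne_empty (symmDiff_eq_right.1 h))
  rw [symmDiff_symmDiff_cancel_right] at hlt
  rw [walshCoeff_vertexForce, one_div_vertexDist_cube hr.le, map_smul, map_smul, smul_eq_mul,
    smul_eq_mul]
  have hscale : 0 < r * (1 / (√3 * r) ^ 3) := by positivity
  linarith [mul_lt_mul_of_pos_left hlt hscale]

lemma walshCoeff_vertexForce_pos {r t : ℝ} (hr : 0 < r) (ht0 : 0 < t) (ht1 : t < 1)
    {S : Finset (Fin 3)} {k : Fin 3} (hS : S.Nonempty) (hSk : S ≠ {k}) :
    0 < walshCoeff S (vertexForce k (t * r) r) := by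
  have hlt := mul_walshCoeff_cubeKernel_lt ht0 ht1 hS hSk
  rw [walshCoeff_vertexForce]
  simp only [vertexDist_comm (t * r) r]
  rw [one_div_vertexDist_cube hr.le, map_smul, map_smul, smul_eq_mul, smul_eq_mul]
  have hscale : 0 < r * (1 / (√3 * r) ^ 3) := by positivity
  linarith [mul_lt_mul_of_pos_left hlt hscale]

/-- The gravitational field at `p` of the masses `x` placed at the vertices of the cube of half
edge `s`. A mass located at `p` itself contributes `0`. -/
noncomputable def cubeField (a : EuclideanSpace ℝ (Fin 3))
    (b : OrthonormalBasis (Fin 3) ℝ (EuclideanSpace ℝ (Fin 3))) (s : ℝ) (x : (Fin 3 → ℤˣ) → ℝ)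
    (p : EuclideanSpace ℝ (Fin 3)) : EuclideanSpace ℝ (Fin 3) :=
  ∑ η, (x η / ‖cubeVertex a b s η - p‖ ^ 3) • (cubeVertex a b s η - p)

section

variable (a : EuclideanSpace ℝ (Fin 3))
  (b : OrthonormalBasis (Fin 3) ℝ (EuclideanSpace ℝ (Fin 3)))

lemma sum_erase_attraction_nestedCubes (r t : ℝ) (m : (Fin 3 → ℤˣ) ⊕ (Fin 3 → ℤˣ) → ℝ)
    (i : (Fin 3 → ℤˣ) ⊕ (Fin 3 → ℤˣ)) :
    ∑ j ∈ univ.erase i, (m j / ‖nestedCubes a b r t j - nestedCubes a b r t i‖ ^ 3) •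
        (nestedCubes a b r t j - nestedCubes a b r t i) =
      cubeField a b r (m ∘ Sum.inl) (nestedCubes a b r t i) +
        cubeField a b (t * r) (m ∘ Sum.inr) (nestedCubes a b r t i) := by
  rw [sum_erase _ (by rw [sub_self, smul_zero]), Fintype.sum_sum_type]
  rfl

lemma repr_cubeVertex_sub (s : ℝ) (ε : Fin 3 → ℤˣ) (k : Fin 3) :
    b.repr (cubeVertex a b s ε - a) k = s * ((ε k : ℤ) : ℝ) := by
  simp [cubeVertex, b.repr_self, Pi.single_apply]

lemma repr_cubeVertex_sub_cubeVertex (s s' : ℝ) (ε η : Fin 3 → ℤˣ) (k : Fin 3) :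
    b.repr (cubeVertex a b s' η - cubeVertex a b s ε) k =
      ((ε k : ℤ) : ℝ) * (s' * (((ε * η) k : ℤ) : ℝ) - s) := by
  rw [← sub_sub_sub_cancel_right _ _ a, map_sub, PiLp.sub_apply, repr_cubeVertex_sub,
    repr_cubeVertex_sub, Pi.mul_apply, Units.val_mul, Int.cast_mul]
  linear_combination (-s' * ((η k : ℤ) : ℝ)) * intUnit_mul_self (ε k)

lemma norm_cubeVertex_sub_cubeVertex (s s' : ℝ) (ε η : Fin 3 → ℤˣ) :
    ‖cubeVertex a b s' η - cubeVertex a b s ε‖ = vertexDist s s' (ε * η) := by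
  rw [← b.repr.norm_map, EuclideanSpace.norm_eq]
  refine congrArg Real.sqrt (sum_congr rfl fun k _ => ?_)
  rw [repr_cubeVertex_sub_cubeVertex, Real.norm_eq_abs, sq_abs, mul_pow, sq ((ε k : ℤ) : ℝ),
    intUnit_mul_self, one_mul]

lemma repr_cubeField_cubeVertex (s s' : ℝ) (x : (Fin 3 → ℤˣ) → ℝ) (ε : Fin 3 → ℤˣ) (k : Fin 3) :
    b.repr (cubeField a b s' x (cubeVertex a b s ε)) k =
      ((ε k : ℤ) : ℝ) * ∑ η, x η * vertexForce k s s' (ε * η) := by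
  simp only [cubeField, map_sum, map_smul, WithLp.ofLp_sum, Finset.sum_apply, PiLp.smul_apply,
    repr_cubeVertex_sub_cubeVertex, norm_cubeVertex_sub_cubeVertex, vertexForce, smul_eq_mul,
    mul_sum]
  exact sum_congr rfl fun η _ => by ring

variable {a b} {r r' s lam : ℝ} {x y : (Fin 3 → ℤˣ) → ℝ} {q₀ : EuclideanSpace ℝ (Fin 3)}

lemma sum_vertexForce_eq_of_equilibrium
    (h : ∀ ε, -lam • (cubeVertex a b s ε - q₀) =
      cubeField a b r x (cubeVertex a b s ε) + cubeField a b r' y (cubeVertex a b s ε))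
    (k : Fin 3) (ε : Fin 3 → ℤˣ) :
    (∑ η, x η * vertexForce k s r (ε * η)) + ∑ η, y η * vertexForce k s r' (ε * η) =
      -lam * s + lam * b.repr (q₀ - a) k * ((ε k : ℤ) : ℝ) := by
  have hk := congrArg (fun v => b.repr v k) (h ε)
  simp only [map_add, PiLp.add_apply, repr_cubeField_cubeVertex] at hk
  rw [← sub_sub_sub_cancel_right _ q₀ a, map_smul, map_sub b.repr (_ - a), PiLp.smul_apply,
    PiLp.sub_apply, repr_cubeVertex_sub, smul_eq_mul] at hk
  linear_combination (-((ε k : ℤ) : ℝ)) * hk +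
    (-(lam * s) - (∑ η, x η * vertexForce k s r (ε * η)) -
      ∑ η, y η * vertexForce k s r' (ε * η)) * intUnit_mul_self (ε k)

lemma walshCoeff_equation_of_equilibrium
    (h : ∀ ε, -lam • (cubeVertex a b s ε - q₀) =
      cubeField a b r x (cubeVertex a b s ε) + cubeField a b r' y (cubeVertex a b s ε))
    {S : Finset (Fin 3)} {k : Fin 3} (hS : S.Nonempty) (hSk : S ≠ {k}) :
    walshCoeff S (vertexForce k s r) * walshCoeff S x +
      walshCoeff S (vertexForce k s r') * walshCoeff S y = 0 := by
  have haffine : (fun ε => ∑ η, x η * vertexForce k s r (ε * η)) +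
      (fun ε => ∑ η, y η * vertexForce k s r' (ε * η)) =
      (-lam * s) • ⇑(signChar ∅) + (lam * b.repr (q₀ - a) k) • ⇑(signChar {k}) := by
    ext ε
    simpa [signChar_apply] using sum_vertexForce_eq_of_equilibrium h k ε
  rw [← walshCoeff_convolution, ← walshCoeff_convolution, ← map_add, haffine, map_add, map_smul,
    map_smul, walshCoeff_signChar_of_ne hS.ne_empty, walshCoeff_signChar_of_ne hSk, smul_zero,
    smul_zero, add_zero]

end

lemma eq_zero_of_linear_system {A B C D x y : ℝ} (hAD : 0 ≤ A * D) (hBC : B * C < 0)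
    (h₁ : A * x + B * y = 0) (h₂ : C * x + D * y = 0) : x = 0 ∧ y = 0 := by
  have hdet : A * D - B * C ≠ 0 := by linarith
  constructor
  · refine (mul_eq_zero.1 ?_).resolve_left hdet
    linear_combination D * h₁ - B * h₂
  · refine (mul_eq_zero.1 ?_).resolve_left hdet
    linear_combination A * h₂ - C * h₁

theorem mainTheorem8_general
    (a : EuclideanSpace ℝ (Fin 3))
    (b : OrthonormalBasis (Fin 3) ℝ (EuclideanSpace ℝ (Fin 3)))
    (r : ℝ) (hr : 0 < r) (t : ℝ) (ht0 : 0 < t) (ht1 : t < 1)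
    (m : (Fin 3 → ℤˣ) ⊕ (Fin 3 → ℤˣ) → ℝ) (lam : ℝ) (q₀ : EuclideanSpace ℝ (Fin 3))
    (hq : ∀ i, -lam • (nestedCubes a b r t i - q₀) =
      ∑ j ∈ univ.erase i, (m j / ‖nestedCubes a b r t j - nestedCubes a b r t i‖ ^ 3) •
        (nestedCubes a b r t j - nestedCubes a b r t i)) :
    (∀ v w : Fin 3 → ℤˣ, m (Sum.inl v) = m (Sum.inl w)) ∧
      (∀ v w : Fin 3 → ℤˣ, m (Sum.inr v) = m (Sum.inr w)) := by
  simp only [sum_erase_attraction_nestedCubes] at hq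
  have hself (S : Finset (Fin 3)) (k : Fin 3) :
      0 ≤ walshCoeff S (vertexForce k r r) * walshCoeff S (vertexForce k (t * r) (t * r)) := by
    rw [vertexForce_mul ht0, map_smul, smul_eq_mul, mul_left_comm]
    exact mul_nonneg (by positivity) (mul_self_nonneg _)
  have hcoeff (S : Finset (Fin 3)) (hS : S.Nonempty) :
      walshCoeff S (m ∘ Sum.inl) = 0 ∧ walshCoeff S (m ∘ Sum.inr) = 0 := by
    obtain ⟨k, hSk⟩ : ∃ k, S ≠ {k} := by
      by_contra! h
      exact absurd (singleton_injective ((h 0).symm.trans (h 1))) (by decide)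
    exact eq_zero_of_linear_system (hself S k)
      (mul_neg_of_neg_of_pos (walshCoeff_vertexForce_neg hr ht0 ht1 hS hSk)
        (walshCoeff_vertexForce_pos hr ht0 ht1 hS hSk))
      (walshCoeff_equation_of_equilibrium (fun ε => hq (Sum.inl ε)) hS hSk)
      (walshCoeff_equation_of_equilibrium (fun ε => hq (Sum.inr ε)) hS hSk)
  exact ⟨eq_of_walshCoeff_eq_zero fun S hS => (hcoeff S hS).1,
    eq_of_walshCoeff_eq_zero fun S hS => (hcoeff S hS).2⟩

theorem mainTheorem8
    (a : EuclideanSpace ℝ (Fin 3))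
    (b : OrthonormalBasis (Fin 3) ℝ (EuclideanSpace ℝ (Fin 3)))
    (r : ℝ) (hr : 0 < r) (t : ℝ) (ht0 : 0 < t) (ht1 : t < 1)
    (m : (Fin 3 → ℤˣ) ⊕ (Fin 3 → ℤˣ) → ℝ) (hm : ∀ i, 0 < m i)
    (hq : IsCentralConfiguration m (nestedCubes a b r t)) :
    (∀ v w : Fin 3 → ℤˣ, m (Sum.inl v) = m (Sum.inl w)) ∧
      (∀ v w : Fin 3 → ℤˣ, m (Sum.inr v) = m (Sum.inr w)) := by
  obtain ⟨lam, hq⟩ := hq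
  exact mainTheorem8_general a b r hr t ht0 ht1 m lam _ hq
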